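/- **Theorem.** Let $E$ be a finite set. A *partition* of $E$ is a set of pairwise disjoint, possibly empty, subsets of $E$ with union $E$; a *partition function* $\psi$ assigns to every partition of $E$ a value in $\mathbb R\cup\{\infty\}$. Write $\bar A=E\smallsetminus A$ and $\psi(A_0,\dots,A_n)=\psi(\{A_0,\dots,A_n\})$. Call $\psi$ *weakly submodular* if for all partitions $\mathcal A=\{A_0,\dots,A_n\}$ and $\mathcal B=\{B_0,\dots,B_m\}$ of $E$ and every choice of $A_0\in\mathcal A$, $B_0\in\mathcal B$, one of the following holds: (a) there is a set $F$ with $A_0\subseteq F\subseteq A_0\cup\bar B_0$ and $\psi(\mathcal A)>\psi(F,A_1\smallsetminus F,\dots,A_n\smallsetminus F)$; (b) $\psi(\mathcal B)\ge\psi(B_0\cup\bar A_0,B_1\cap A_0,\dots,B_m\cap A_0)$. Order the pairs $(A,\bar A)$, $A\subseteq E$, by $(A,\bar A)\le(C,\bar C)$ iff $A\subseteq C$, with the involution $(A,\bar A)^*=(\bar A,A)$. For real $k>0$ let $\vec S_k$ be the set of all $(A,\bar A)$ with $\psi(A,\bar A)<k$, let $S_k$ be the set of the corresponding unoriented $\{\vec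 s,\vec s^{\,*}\}$, and put $$\mathcal F_k=\big\{\sigma(\mathcal A):\psi(\mathcal A)<k\big\}\cup\big\{\{(\bar X,X)\}:|X|\le1,\ \psi(\bar X,X)<k\big\},\qquad \sigma(\mathcal A)=\{(A,\bar A):A\in\mathcal A\}.$$ Let $\psi$ be weakly submodular and monotone (with respect to $k$), i.e. every element of $\mathcal F_k$ is a subset of $\vec S_k$. Assume that $|E|\ge2$ or $\vec S_k\ne\emptyset$. Then the following assertions are equivalent. 1. There is a non-principal $k$-bramble for $\psi$: a non-empty set $\mathcal B$ of subsets of $E$, any two of which (equal or not) have non-empty intersection, that contains an element of every partition $\mathcal A$ of $E$ with $\psi(\mathcal A)<k$ and contains no singleton $\{e\}$. 2. $S_k$ has an $\mathcal F_k$-tangle: a set $O\subseteq\vec S_k$ containing exactly one element of each $\{\vec s,\vec s^{\,*}\}\in S_k$, such that no element of $\mathcal F_k$ is a subset of $O$, and such that there are no $\vec r<\vec s$ in $\vec S_k$ with $\{\vec r,\vec r^{\,*}\}\neq\{\vec s,\vec s^{\,*}\}$ and $\vec r^{\,*},\vec s\in O$. 3. There is no $S_k$-tree over $\mathcal F_k$: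 no finite tree $T$ with at least one edge and map $\alpha$ from the set of oriented edges $(x,y)$ of $T$ to $\vec S_k$ such that $\alpha(y,x)=\alpha(x,y)^*$ for every edge $xy$, and $\{\alpha(x,t):xt\in E(T)\}\in\mathcal F_k$ for every node $t$. 4. There is no partitioning $k$-search tree: no finite tree $T$ with at least one edge and labelling $\ell$ of its oriented edges by subsets of $E$ such that $\ell(y,x)=E\smallsetminus\ell(x,y)$ for every edge $xy$; for every leaf $t$ with neighbour $x$ the set $X=\ell(x,t)$ satisfies $|X|\le1$ and $\psi(X,\bar X)<k$; and for every node $t$ with at least two neighbours the sets $\ell(t,x)$, for the neighbours $x$ of $t$, are pairwise disjoint and form a partition of $E$ with $\psi$-value less than $k$. -/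

import Mathlib

namespace PartitionDuality

/-! ### Separation systems, orientations, tangles and trees -/

/-- A separation system: a partially ordered set with an order-reversing involution. -/
class SeparationSystem (U : Type*) extends PartialOrder U where
  /-- The inverse of an oriented separation. -/
  inv : U → U
  inv_inv : ∀ s, inv (inv s) = s
  inv_le_inv : ∀ {r s : U}, r ≤ s → inv s ≤ inv r

section Systems

variable {U : Type*} [SeparationSystem U]

open SeparationSystem (inv)

/-- `O` is an orientation of the set of separations whose set of orientations is `S`: it consists
of elements of `S`, and contains exactly one element of `{s, s*}` for every `s ∈ S`. -/
def IsOrientation (S O : Set U) : Prop :=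
  O ⊆ S ∧ ∀ s ∈ S, ∃! r, r ∈ O ∧ (r = s ∨ r = inv s)

/-- `O` is consistent: there are no distinct (unoriented) separations `{r, r*} ≠ {s, s*}` in `S`
with orientations `r < s` such that `r*, s ∈ O`. -/
def IsConsistent (S O : Set U) : Prop :=
  ¬ ∃ r ∈ S, ∃ s ∈ S, r ≠ s ∧ r ≠ inv s ∧ r < s ∧ inv r ∈ O ∧ s ∈ O

/-- `O` avoids `F`: no member of `F` is a subset of `O`. -/
def Avoids (O : Set U) (F : Set (Set U)) : Prop :=
  ∀ σ ∈ F, ¬ σ ⊆ O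

/-- An `F`-tangle of `S`: a consistent orientation of `S` that avoids `F`. -/
def IsTangle (S : Set U) (F : Set (Set U)) (O : Set U) : Prop :=
  IsOrientation S O ∧ IsConsistent S O ∧ Avoids O F

/-- `(T, α)` is an `S`-tree over `F`: `T` is a tree with at least one edge, `α` maps the oriented
edges of `T` to `S` and commutes with inversion, and for every node `t` the image under `α` of
the set of oriented edges with head `t` lies in `F`. -/
structure IsSTreeOver (S : Set U) (F : Set (Set U)) {V : Type} (T : SimpleGraph V)
    (α : T.Dart → U) : Prop where
  isTree : T.IsTree
  nonempty_dart : Nonempty T.Dart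
  mem : ∀ d, α d ∈ S
  symm : ∀ d, α d.symm = inv (α d)
  star_mem : ∀ t : V, α '' {d | d.snd = t} ∈ F

/-- There exists a (finite) `S`-tree over `F`. -/
def ExistsSTreeOver (S : Set U) (F : Set (Set U)) : Prop :=
  ∃ (V : Type) (_ : Finite V) (T : SimpleGraph V) (α : T.Dart → U), IsSTreeOver S F T α

end Systems

/-! ### The universe of bipartitions `(A, E ∖ A)` -/

/-- An oriented bipartition `(A, E ∖ A)` of `E`. -/
@[ext]
structure Bipartition (E : Type*) where
  /-- The first side `A`. -/
  fst : Set E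
  /-- The second side `E ∖ A`. -/
  snd : Set E
  snd_eq : snd = fstᶜ

namespace Bipartition

variable {E : Type*}

/-- The oriented bipartition `(A, E ∖ A)`. -/
def of (A : Set E) : Bipartition E := ⟨A, Aᶜ, rfl⟩

/-- `(A, B) ≤ (C, D)` means `A ⊆ C` and `D ⊆ B`; the inverse of `(A, B)` is `(B, A)`. -/
instance : SeparationSystem (Bipartition E) where
  le r s := r.fst ⊆ s.fst ∧ s.snd ⊆ r.snd
  le_refl r := ⟨subset_rfl, subset_rfl⟩
  le_trans r s t h h' := ⟨h.1.trans h'.1, h'.2.trans h.2⟩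
  le_antisymm r s h h' := Bipartition.ext (h.1.antisymm h'.1) (h'.2.antisymm h.2)
  inv s := ⟨s.snd, s.fst, by rw [s.snd_eq, compl_compl]⟩
  inv_inv _ := rfl
  inv_le_inv h := ⟨h.2, h.1⟩

end Bipartition

/-! ### Partition functions -/

/-- A partition of `E`: a set of disjoint, possibly empty, subsets of `E` with union `E`. -/
@[ext]
structure SetPartition (E : Type*) where
  /-- The set of parts; the empty set may be one of them. -/
  parts : Set (Set E)
  disjoint : ∀ A ∈ parts, ∀ B ∈ parts, A ≠ B → Disjoint A B
  sUnion_eq : ⋃₀ parts = Set.univ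

namespace SetPartition

variable {E : Type*}

/-- The partition `{A, E ∖ A}`. -/
def pair (A : Set E) : SetPartition E where
  parts := {A, Aᶜ}
  disjoint := by
    rintro X (rfl | rfl) Y (rfl | rfl) h
    · exact absurd rfl h
    · exact disjoint_compl_right
    · exact disjoint_compl_left
    · exact absurd rfl h
  sUnion_eq := by simp

/-- For a partition `{A₀, A₁, …, Aₙ}` and a set `F ⊇ A₀`, the partition
`{F, A₁ ∖ F, …, Aₙ ∖ F}`. -/
def enlarge (P : SetPartition E) (A₀ F : Set E) (hF : A₀ ⊆ F) : SetPartition E where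
  parts := {F} ∪ (fun A => A \ F) '' (P.parts \ {A₀})
  disjoint := by
    rintro X (rfl | ⟨A, hA, rfl⟩) Y (rfl | ⟨B, hB, rfl⟩) h
    · exact absurd rfl h
    · exact Set.disjoint_sdiff_right
    · exact Set.disjoint_sdiff_left
    · refine (P.disjoint A hA.1 B hB.1 ?_).mono Set.sdiff_subset Set.sdiff_subset
      rintro rfl
      exact h rfl
  sUnion_eq := by
    refine Set.eq_univ_of_forall fun x => ?_
    by_cases hx : x ∈ F
    · exact ⟨F, Or.inl rfl, hx⟩
    · obtain ⟨A, hA, hxA⟩ : x ∈ ⋃₀ P.parts := P.sUnion_eq ▸ Set.mem_univ x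
      refine ⟨A \ F, Or.inr ⟨A, ⟨hA, ?_⟩, rfl⟩, hxA, hx⟩
      rintro rfl
      exact hx (hF hxA)

/-- For a partition `{B₀, B₁, …, Bₘ}` and a set `A₀`, the partition
`{B₀ ∪ (E ∖ A₀), B₁ ∩ A₀, …, Bₘ ∩ A₀}`. -/
def shrink (P : SetPartition E) (B₀ A₀ : Set E) (hB : B₀ ∈ P.parts) : SetPartition E where
  parts := {B₀ ∪ A₀ᶜ} ∪ (fun B => B ∩ A₀) '' (P.parts \ {B₀})
  disjoint := by
    have key : ∀ B ∈ P.parts \ {B₀}, Disjoint (B₀ ∪ A₀ᶜ) (B ∩ A₀) := fun B hB' =>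
      Disjoint.sup_left ((P.disjoint B₀ hB B hB'.1 (Ne.symm hB'.2)).mono_right
        Set.inter_subset_left) (disjoint_compl_left.mono_right Set.inter_subset_right)
    rintro X (rfl | ⟨A, hA, rfl⟩) Y (rfl | ⟨B, hB', rfl⟩) h
    · exact absurd rfl h
    · exact key B hB'
    · exact (key A hA).symm
    · refine (P.disjoint A hA.1 B hB'.1 ?_).mono Set.inter_subset_left Set.inter_subset_left
      rintro rfl
      exact h rfl
  sUnion_eq := by
    refine Set.eq_univ_of_forall fun x => ?_
    by_cases hx : x ∈ B₀ ∪ A₀ᶜ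
    · exact ⟨_, Or.inl rfl, hx⟩
    · obtain ⟨B, hB', hxB⟩ : x ∈ ⋃₀ P.parts := P.sUnion_eq ▸ Set.mem_univ x
      have hxA : x ∈ A₀ := by
        by_contra h
        exact hx (Or.inr h)
      refine ⟨B ∩ A₀, Or.inr ⟨B, ⟨hB', ?_⟩, rfl⟩, hxB, hxA⟩
      rintro rfl
      exact hx (Or.inl hxB)

/-- The set `σ(𝒜) = {(A₀, E ∖ A₀), …, (Aₙ, E ∖ Aₙ)}` for a partition `𝒜 = {A₀, …, Aₙ}`. -/
def star (P : SetPartition E) : Set (Bipartition E) := Bipartition.of '' P.parts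

end SetPartition

section PartitionFunctions

variable {E : Type*}

/-- A partition function `ψ`, with values in `ℝ ∪ {∞}`, is weakly submodular. -/
def IsWeaklySubmodular (ψ : SetPartition E → WithTop ℝ) : Prop :=
  ∀ (𝒜 ℬ : SetPartition E) (A₀ B₀ : Set E) (_ : A₀ ∈ 𝒜.parts) (hB : B₀ ∈ ℬ.parts),
    (∃ (F : Set E) (hF : A₀ ⊆ F), F ⊆ A₀ ∪ B₀ᶜ ∧ ψ 𝒜 > ψ (𝒜.enlarge A₀ F hF)) ∨
      ψ ℬ ≥ ψ (ℬ.shrink B₀ A₀ hB)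

/-- The set of oriented bipartitions `(A, E ∖ A)` with `ψ(A, E ∖ A) < k`. -/
def sepSystem (ψ : SetPartition E → WithTop ℝ) (k : ℝ) : Set (Bipartition E) :=
  {s | ψ (SetPartition.pair s.fst) < (k : WithTop ℝ)}

/-- The set `F_k` consisting of all `σ(𝒜)` with `ψ(𝒜) < k` and of all `{(E ∖ X, X)}` with
`|X| ≤ 1` and `ψ(E ∖ X, X) < k`. -/
def forbiddenStars (ψ : SetPartition E → WithTop ℝ) (k : ℝ) : Set (Set (Bipartition E)) :=
  {σ | ∃ 𝒜 : SetPartition E, ψ 𝒜 < (k : WithTop ℝ) ∧ σ = 𝒜.star} ∪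
    {σ | ∃ X : Set E, X.ncard ≤ 1 ∧ ψ (SetPartition.pair Xᶜ) < (k : WithTop ℝ) ∧
      σ = {Bipartition.of Xᶜ}}

/-- `ψ` is monotone (with respect to `k`): all elements of `F_k` are subsets of `S_k`. -/
def IsMonotoneAt (ψ : SetPartition E → WithTop ℝ) (k : ℝ) : Prop :=
  ∀ σ ∈ forbiddenStars ψ k, σ ⊆ sepSystem ψ k

/-- A `k`-bramble for `ψ`: a non-empty set of pairwise intersecting subsets of `E` (so that none
of them is empty) that contains a part of every partition `𝒜` with `ψ(𝒜) < k`. -/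
structure IsBramble (ψ : SetPartition E → WithTop ℝ) (k : ℝ) (B : Set (Set E)) : Prop where
  nonempty : B.Nonempty
  inter_nonempty : ∀ X ∈ B, ∀ Y ∈ B, (X ∩ Y).Nonempty
  exists_mem : ∀ 𝒜 : SetPartition E, ψ 𝒜 < (k : WithTop ℝ) → ∃ A ∈ 𝒜.parts, A ∈ B

/-- A set of subsets of `E` is non-principal if it contains no singleton. -/
def IsNonprincipal (B : Set (Set E)) : Prop := ∀ e : E, {e} ∉ B

/-- `(T, ℓ)` is a partitioning `k`-search tree: `T` is a tree with at least one edge, `ℓ` labels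
every oriented edge `(x, y)` with a subset of `E`, to be thought of as the part of `E` that lies
on the side of `y`, so that the two orientations of an edge have complementary labels; the
edge `(x, t)` pointing to a leaf `t` has a label `X` with `|X| ≤ 1` and `ψ(X, E ∖ X) < k`; and at
every other node `t` the labels of the edges leaving `t` are disjoint and form a partition of `E`
of value `< k`. -/
structure IsPartitioningSearchTree (ψ : SetPartition E → WithTop ℝ) (k : ℝ) {V : Type}
    (T : SimpleGraph V) (l : T.Dart → Set E) : Prop where
  isTree : T.IsTree
  nonempty_dart : Nonempty T.Dart
  symm : ∀ d, l d.symm = (l d)ᶜ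
  leaf : ∀ d : T.Dart, (T.neighborSet d.snd).ncard = 1 →
    (l d).ncard ≤ 1 ∧ ψ (SetPartition.pair (l d)) < (k : WithTop ℝ)
  disjoint : ∀ t : V, 2 ≤ (T.neighborSet t).ncard →
    ∀ d d' : T.Dart, d.fst = t → d'.fst = t → d ≠ d' → Disjoint (l d) (l d')
  partition : ∀ t : V, 2 ≤ (T.neighborSet t).ncard →
    ∃ 𝒜 : SetPartition E, 𝒜.parts = l '' {d | d.fst = t} ∧ ψ 𝒜 < (k : WithTop ℝ)

/-- There exists a (finite) partitioning `k`-search tree for `ψ`. -/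
def ExistsPartitioningSearchTree (ψ : SetPartition E → WithTop ℝ) (k : ℝ) : Prop :=
  ∃ (V : Type) (_ : Finite V) (T : SimpleGraph V) (l : T.Dart → Set E),
    IsPartitioningSearchTree ψ k T l

end PartitionFunctions

end PartitionDuality

namespace PartitionDuality

open SeparationSystem (inv)

section Duality

variable {E : Type*}

/-! The implications form a cycle. A bramble orients each bipartition towards its side in the
bramble. A tangle orients every edge of an $S_k$-tree, and the star at a sink would be forbidden. A
search tree becomes an $S_k$-tree by relabelling its edges. The substance is the construction of a
bramble when no search tree exists.

Fix a down-set $N$ of admissible leaf labels containing all sets of size at most one, and maximal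
such that no tree has all its leaves in $N$. The bramble is the complement of $N$. A partition of
value $<k$ with all parts in $N$ would itself be a tree. If disjoint $X,Y\notin N$ existed, choose
minimal $A\subseteq X$ and $B\subseteq Y$ outside $N$. By maximality, admitting $A$ as a leaf
creates a tree; as $A\ne\emptyset$, it labels essentially one leaf, and rerooting there gives a
branch with root label $\bar A$ and leaves in $N$ (`Branch.of_insert`). The same holds for $\bar B$.

These branches fit only loosely, since $A\subseteq\bar B$ may be strict. Weak submodularity repairs
a loose edge: (a) enlarges the part on the parent side and lowers that node's value, while (b)
shrinks the child's partition without raising its value, so that its part towards the root grows. An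
integer cost drops each time (`LooseBranch.branch_or_improve`), so the process ends with a genuine
tree over $N$, a contradiction. If no bipartition has value $<k$, then $\{E\}$ is a bramble. -/

theorem SetPartition.pair_compl (A : Set E) : SetPartition.pair Aᶜ = SetPartition.pair A := by
  ext1
  simp [SetPartition.pair, Set.pair_comm]

theorem Bipartition.inv_of (A : Set E) : inv (Bipartition.of A) = Bipartition.of Aᶜ := by
  ext1
  · rfl
  · simp [Bipartition.of, inv]

theorem Bipartition.of_fst (s : Bipartition E) : Bipartition.of s.fst = s := by
  ext1
  · rfl
  · exact s.snd_eq.symm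

theorem mem_sepSystem_of {ψ : SetPartition E → WithTop ℝ} {k : ℝ} {A : Set E} :
    Bipartition.of A ∈ sepSystem ψ k ↔ ψ (SetPartition.pair A) < (k : WithTop ℝ) := Iff.rfl

theorem IsMonotoneAt.pair_lt {ψ : SetPartition E → WithTop ℝ} {k : ℝ} (hmono : IsMonotoneAt ψ k)
    {𝒜 : SetPartition E} (h𝒜 : ψ 𝒜 < (k : WithTop ℝ)) {A : Set E} (hA : A ∈ 𝒜.parts) :
    ψ (SetPartition.pair A) < (k : WithTop ℝ) :=
  hmono 𝒜.star (Or.inl ⟨𝒜, h𝒜, rfl⟩) ⟨A, hA, rfl⟩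

/-! ### From brambles to tangles -/

/-- A non-principal bramble orients every separation towards its side in the bramble. -/
theorem exists_isTangle_of_isBramble [Finite E] {ψ : SetPartition E → WithTop ℝ} {k : ℝ}
    {B : Set (Set E)} (hB : IsBramble ψ k B) (hB' : IsNonprincipal B) :
    ∃ O, IsTangle (sepSystem ψ k) (forbiddenStars ψ k) O := by
  have hcompl : ∀ X ∈ B, Xᶜ ∉ B := fun X hX hX' => by
    simpa using hB.inter_nonempty X hX _ hX'
  refine ⟨{s | s ∈ sepSystem ψ k ∧ s.snd ∈ B}, ⟨fun s hs => hs.1, ?_⟩, ?_, ?_⟩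
  · intro s hs
    have hinv : inv s ∈ sepSystem ψ k := by
      rw [← s.of_fst, Bipartition.inv_of, mem_sepSystem_of, SetPartition.pair_compl]
      exact hs
    obtain ⟨A, hA, hAB⟩ := hB.exists_mem _ hs
    rcases hA with rfl | rfl
    · refine ⟨inv s, ⟨⟨hinv, hAB⟩, Or.inr rfl⟩, ?_⟩
      rintro r ⟨⟨_, hr⟩, rfl | rfl⟩
      · exact absurd (r.snd_eq ▸ hr) (hcompl _ hAB)
      · rfl
    · refine ⟨s, ⟨⟨hs, by rw [s.snd_eq]; exact hAB⟩, Or.inl rfl⟩, ?_⟩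
      rintro r ⟨⟨_, hr⟩, rfl | rfl⟩
      · rfl
      · exact absurd hAB (hcompl _ hr)
  · rintro ⟨r, _, s, _, _, _, hrs, hr, hs⟩
    obtain ⟨x, hx, hx'⟩ := hB.inter_nonempty _ hr.2 _ hs.2
    rw [s.snd_eq] at hx'
    exact hx' (hrs.le.1 hx)
  · rintro σ (⟨𝒜, h𝒜, rfl⟩ | ⟨X, hX, _, rfl⟩) hσ
    · obtain ⟨A, hA, hAB⟩ := hB.exists_mem 𝒜 h𝒜
      exact hcompl A hAB (hσ ⟨A, hA, rfl⟩).2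
    -- A bramble set meets itself, so it is non-empty, and $|X|\le1$ leaves only a singleton.
    · have hXB : X ∈ B := by simpa [Bipartition.of] using (hσ rfl).2
      obtain ⟨x, hx, -⟩ := hB.inter_nonempty X hXB X hXB
      obtain rfl : X = {x} :=
        (Set.eq_singleton_iff_unique_mem.2 ⟨hx, fun y hy => (Set.ncard_le_one_iff).1 hX hy hx⟩)
      exact hB' x hXB

/-! ### Tangles and trees exclude each other -/

/-- Every orientation of the edges of a finite tree has a sink, since a tree has fewer edges than
vertices. -/
theorem exists_sink_of_isTree {V : Type} [Finite V] {T : SimpleGraph V} (hT : T.IsTree)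
    (P : T.Dart → Prop) (hP : ∀ d, P d ∨ P d.symm) :
    ∃ t : V, ∀ d : T.Dart, d.snd = t → P d := by
  classical
  by_contra! h
  choose f hf hPf using h
  -- Two vertices choosing the same edge would choose its two orientations, both violating `P`.
  have hinj : Function.Injective fun t => (⟨(f t).edge, (f t).edge_mem⟩ : T.edgeSet) := by
    intro s t hst
    rcases SimpleGraph.dart_edge_eq_iff _ _ |>.1 (Subtype.ext_iff.1 hst) with h | h
    · rw [← hf s, h, hf t]
    · rcases hP (f t) with h' | h'
      · exact absurd h' (hPf t)
      · exact absurd (h ▸ h') (hPf s)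
  have h1 : Nat.card V ≤ Nat.card T.edgeSet := Nat.card_le_card_of_injective _ hinj
  have h2 := (SimpleGraph.isTree_iff_connected_and_card.1 hT).2
  omega

/-- Orient each edge by its orientation lying in `O`; all darts entering a sink then have their
images in `O`, and these form a star in `F`. -/
theorem not_existsSTreeOver_of_isTangle {U : Type*} [SeparationSystem U] {S O : Set U}
    {F : Set (Set U)} (hO : IsTangle S F O) : ¬ ExistsSTreeOver S F := by
  rintro ⟨V, _, T, α, h⟩
  obtain ⟨t, ht⟩ := exists_sink_of_isTree h.isTree (fun d => α d ∈ O) fun d => by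
    obtain ⟨r, ⟨hr, rfl | rfl⟩, -⟩ := hO.1.2 _ (h.mem d)
    · exact Or.inl hr
    · exact Or.inr (by rw [h.symm]; exact hr)
  refine hO.2.2 _ (h.star_mem t) ?_
  rintro _ ⟨d, hd, rfl⟩
  exact ht d hd

/-- A search label records the side of the head, which is the second side of the separation; hence
the reversed dart in `l d.symm`. -/
theorem existsSTreeOver_of_existsPartitioningSearchTree {ψ : SetPartition E → WithTop ℝ} {k : ℝ}
    (hmono : IsMonotoneAt ψ k) (h : ExistsPartitioningSearchTree ψ k) :
    ExistsSTreeOver (sepSystem ψ k) (forbiddenStars ψ k) := by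
  obtain ⟨V, _, T, l, h⟩ := h
  have hstar : ∀ t : V,
      (fun d : T.Dart => Bipartition.of (l d.symm)) '' {d | d.snd = t} ∈ forbiddenStars ψ k := by
    intro t
    obtain ⟨d₀⟩ := h.nonempty_dart
    have : Nontrivial V := ⟨_, _, d₀.adj.ne⟩
    obtain ⟨x, hx⟩ := h.isTree.1.preconnected.exists_adj_of_nontrivial t
    have hpos : 0 < (T.neighborSet t).ncard := (Set.ncard_pos).2 ⟨x, hx⟩
    rcases (show (T.neighborSet t).ncard = 1 ∨ 2 ≤ (T.neighborSet t).ncard by omega) with h1 | h2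
    · right
      let d : T.Dart := ⟨(x, t), hx.symm⟩
      obtain ⟨hX, hψ⟩ := h.leaf d h1
      refine ⟨l d, hX, by rwa [SetPartition.pair_compl], ?_⟩
      have huniq : {d : T.Dart | d.snd = t} = {d} := by
        refine Set.eq_singleton_iff_unique_mem.2 ⟨rfl, fun d' hd' => ?_⟩
        obtain ⟨a, ha⟩ := Set.ncard_eq_one.1 h1
        have e1 : d'.fst ∈ T.neighborSet t := by
          have := d'.adj.symm
          rwa [show d'.snd = t from hd'] at this
        have e2 : x ∈ T.neighborSet t := hx
        rw [ha, Set.mem_singleton_iff] at e1 e2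
        exact SimpleGraph.Dart.ext _ _ (Prod.ext (e1.trans e2.symm) hd')
      rw [huniq, Set.image_singleton, h.symm]
    · left
      obtain ⟨𝒜, h𝒜, hψ⟩ := h.partition t h2
      refine ⟨𝒜, hψ, ?_⟩
      rw [SetPartition.star, h𝒜, Set.image_image]
      ext s
      constructor
      · rintro ⟨d, hd, rfl⟩
        exact ⟨d.symm, hd, rfl⟩
      · rintro ⟨d, hd, rfl⟩
        exact ⟨d.symm, hd, by simp⟩
  refine ⟨V, ‹_›, T, fun d => Bipartition.of (l d.symm), h.isTree, h.nonempty_dart, ?_, ?_, hstar⟩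
  · exact fun d => hmono _ (hstar d.snd) ⟨d, rfl, rfl⟩
  · intro d
    rw [Bipartition.inv_of, h.symm d.symm]

end Duality

/-! ### Branches of search trees -/

section Branches

variable {E : Type*}

/-- `Branch ψ k N X` says that there is a rooted tree with labels as in a partitioning `k`-search
tree whose root edge has label `X` and whose leaves have labels in `N`. -/
inductive Branch (ψ : SetPartition E → WithTop ℝ) (k : ℝ) (N : Set (Set E)) : Set E → Prop
  | leaf (X : Set E) : X ∈ N → ψ (SetPartition.pair X) < (k : WithTop ℝ) → Branch ψ k N X
  | node (X : Set E) (𝒜 : SetPartition E) : Xᶜ ∈ 𝒜.parts → ψ 𝒜 < (k : WithTop ℝ) →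
      (∀ A ∈ 𝒜.parts, A ≠ Xᶜ → Branch ψ k N A) → Branch ψ k N X

/-- The number of partitions of smaller value. -/
noncomputable def rank (ψ : SetPartition E → WithTop ℝ) (𝒜 : SetPartition E) : ℕ :=
  {ℬ | ψ ℬ < ψ 𝒜}.ncard

/-- The cost of a partition together with its part pointing to the root. Lowering the value of
the partition outweighs any change of the part. -/
noncomputable def nodeCost (ψ : SetPartition E → WithTop ℝ) (𝒜 : SetPartition E) (U : Set E) : ℕ :=
  rank ψ 𝒜 * (Nat.card E + 1) + Uᶜ.ncard

/-- A version of `Branch` in which the labels of the two orientations of an edge need only be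
disjoint; `n` bounds the sum of the costs of the inner nodes. -/
inductive LooseBranch (ψ : SetPartition E → WithTop ℝ) (k : ℝ) (N : Set (Set E)) :
    Set E → ℕ → Prop
  | leaf (X : Set E) (n : ℕ) : X ∈ N → LooseBranch ψ k N X n
  | node (X U : Set E) (n : ℕ) (𝒜 : SetPartition E) (C : Finset (Set E)) (c : Set E → ℕ) :
      Disjoint X U → U ∈ 𝒜.parts → ψ 𝒜 < (k : WithTop ℝ) →
      (∀ A ∈ 𝒜.parts, A ≠ U → A ∈ C) → (∀ A ∈ C, LooseBranch ψ k N A (c A)) →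
      nodeCost ψ 𝒜 U + ∑ A ∈ C, c A ≤ n → LooseBranch ψ k N X n

variable {ψ : SetPartition E → WithTop ℝ} {k : ℝ} {N : Set (Set E)}

/-! ### Ranks and costs -/

theorem finite_setPartition [Finite E] : Finite (SetPartition E) :=
  Finite.of_injective SetPartition.parts fun _ _ h => SetPartition.ext h

theorem rank_mono [Finite E] {𝒜 ℬ : SetPartition E} (h : ψ 𝒜 ≤ ψ ℬ) : rank ψ 𝒜 ≤ rank ψ ℬ := by
  have := finite_setPartition (E := E)
  exact Set.ncard_le_ncard (fun 𝒞 h𝒞 => lt_of_lt_of_le h𝒞 h) (Set.toFinite _)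

theorem rank_strictMono [Finite E] {𝒜 ℬ : SetPartition E} (h : ψ 𝒜 < ψ ℬ) :
    rank ψ 𝒜 < rank ψ ℬ := by
  have := finite_setPartition (E := E)
  refine Set.ncard_lt_ncard ⟨fun 𝒞 h𝒞 => lt_trans h𝒞 h, fun hsub => ?_⟩ (Set.toFinite _)
  exact lt_irrefl (ψ 𝒜) (hsub (show 𝒜 ∈ {𝒞 | ψ 𝒞 < ψ ℬ} from h))

/-- One unit of rank weighs $|E|+1$, more than the second summand can ever be. -/
theorem nodeCost_lt_of_lt [Finite E] {𝒜 ℬ : SetPartition E} (h : ψ 𝒜 < ψ ℬ) (U U' : Set E) :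
    nodeCost ψ 𝒜 U < nodeCost ψ ℬ U' := by
  have h1 := rank_strictMono h
  have h2 : Uᶜ.ncard ≤ Nat.card E := Set.ncard_le_card _
  have h3 : (rank ψ 𝒜 + 1) * (Nat.card E + 1) ≤ rank ψ ℬ * (Nat.card E + 1) :=
    Nat.mul_le_mul_right _ h1
  unfold nodeCost
  linarith

theorem nodeCost_lt_of_ssubset [Finite E] {𝒜 ℬ : SetPartition E} (h : ψ 𝒜 ≤ ψ ℬ) {U U' : Set E}
    (hU : U' ⊂ U) : nodeCost ψ 𝒜 U < nodeCost ψ ℬ U' :=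
  add_lt_add_of_le_of_lt (Nat.mul_le_mul_right _ (rank_mono h))
    (Set.ncard_lt_ncard (compl_lt_compl_iff_lt.2 hU) (Set.toFinite _))

/-! ### Tightening loose branches -/

/-- Shrinking the root label preserves disjointness, so nothing below the root has to change. This
is the gain from loose edges. -/
theorem LooseBranch.mono (hN : IsLowerSet N) {X Y : Set E} {n : ℕ} (h : LooseBranch ψ k N X n)
    (hYX : Y ⊆ X) : LooseBranch ψ k N Y n := by
  cases h with
  | leaf _ _ hX => exact .leaf _ _ (hN hYX hX)
  | node _ U _ 𝒜 C c hXU hU h𝒜 hC h hn =>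
    exact .node Y U n 𝒜 C c (hXU.mono_left hYX) hU h𝒜 hC h hn

/-- Cost functions can be pushed forward along shrinking maps of the children. -/
theorem exists_cost_image [DecidableEq (Set E)] (hN : IsLowerSet N) (C : Finset (Set E))
    (c : Set E → ℕ) (hC : ∀ A ∈ C, LooseBranch ψ k N A (c A)) (f : Set E → Set E)
    (hf : ∀ A ∈ C, f A ⊆ A) :
    ∃ c' : Set E → ℕ, (∀ A ∈ C.image f, LooseBranch ψ k N A (c' A)) ∧
      ∑ A ∈ C.image f, c' A ≤ ∑ A ∈ C, c A := by
  induction C using Finset.induction_on with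
  | empty => exact ⟨c, by simp, by simp⟩
  | insert a s ha ih =>
    obtain ⟨c', hc', hle⟩ := ih (fun A hA => hC A (Finset.mem_insert_of_mem hA))
      (fun A hA => hf A (Finset.mem_insert_of_mem hA))
    rw [Finset.image_insert, Finset.sum_insert ha]
    -- Distinct children may collapse to one set; the branch already there is kept and the cost of
    -- `a` is discarded.
    by_cases hmem : f a ∈ s.image f
    · exact ⟨c', by simpa [Finset.insert_eq_of_mem hmem] using hc', by
        rw [Finset.insert_eq_of_mem hmem]; omega⟩
    · have hne : ∀ A ∈ s.image f, A ≠ f a := fun A hA h => hmem (h ▸ hA)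
      refine ⟨Function.update c' (f a) (c a), fun A hA => ?_, ?_⟩
      · rcases Finset.mem_insert.1 hA with rfl | hA
        · rw [Function.update_self]
          exact (hC a (Finset.mem_insert_self _ _)).mono hN (hf a (Finset.mem_insert_self _ _))
        · rw [Function.update_of_ne (hne A hA)]
          exact hc' A hA
      · rw [Finset.sum_insert hmem, Function.update_self,
          Finset.sum_congr rfl fun A hA => Function.update_of_ne (hne A hA) _ _]
        omega

/-- Children of a partition enlarged at the child `A₀`. -/
theorem exists_cost_enlarge [DecidableEq (Set E)] (hN : IsLowerSet N) (C : Finset (Set E))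
    (c : Set E → ℕ) (hC : ∀ A ∈ C, LooseBranch ψ k N A (c A)) {A₀ F : Set E} (hA₀ : A₀ ∈ C)
    (hF : LooseBranch ψ k N F (c A₀)) :
    ∃ (C' : Finset (Set E)) (c' : Set E → ℕ), F ∈ C' ∧ (∀ A ∈ C, A ≠ A₀ → A \ F ∈ C') ∧
      (∀ A ∈ C', LooseBranch ψ k N A (c' A)) ∧ ∑ A ∈ C', c' A ≤ ∑ A ∈ C, c A := by
  obtain ⟨c', hc', hle⟩ := exists_cost_image hN (C.erase A₀) c
    (fun A hA => hC A (Finset.mem_of_mem_erase hA)) (fun A => A \ F) fun A _ => Set.sdiff_subset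
  have hsum := Finset.add_sum_erase C c hA₀
  set D := (C.erase A₀).image fun A => A \ F with hD
  have hmem : ∀ A ∈ C, A ≠ A₀ → A \ F ∈ D := fun A hA hne =>
    Finset.mem_image_of_mem _ (Finset.mem_erase.2 ⟨hne, hA⟩)
  by_cases hFD : F ∈ D
  · exact ⟨D, c', hFD, hmem, hc', by omega⟩
  · have hne : ∀ A ∈ D, A ≠ F := fun A hA h => hFD (h ▸ hA)
    refine ⟨insert F D, Function.update c' F (c A₀), Finset.mem_insert_self _ _,
      fun A hA h => Finset.mem_insert_of_mem (hmem A hA h), fun A hA => ?_, ?_⟩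
    · rcases Finset.mem_insert.1 hA with rfl | hA
      · rwa [Function.update_self]
      · rw [Function.update_of_ne (hne A hA)]
        exact hc' A hA
    · rw [Finset.sum_insert hFD, Function.update_self,
        Finset.sum_congr rfl fun A hA => Function.update_of_ne (hne A hA) _ _]
      omega

/-- Lowering the cost of one child. -/
theorem sum_update_lt [DecidableEq (Set E)] {C : Finset (Set E)} (c : Set E → ℕ) {A : Set E}
    (hA : A ∈ C) {m : ℕ} (hm : m < c A) :
    ∑ B ∈ C, Function.update c A m B < ∑ B ∈ C, c B := by
  refine Finset.sum_lt_sum (fun B _ => ?_) ⟨A, hA, by simpa using hm⟩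
  rcases eq_or_ne B A with rfl | h
  · simpa using hm.le
  · rw [Function.update_of_ne h]

/-- A loose branch attached to a partition is tight, or its cost can be lowered, or the value of
the partition can be lowered. -/
theorem LooseBranch.branch_or_improve [Finite E] (hsub : IsWeaklySubmodular ψ)
    (hmono : IsMonotoneAt ψ k) (hN : IsLowerSet N) {X : Set E} {n : ℕ}
    (h : LooseBranch ψ k N X n) : ∀ 𝒜 : SetPartition E, ψ 𝒜 < (k : WithTop ℝ) → X ∈ 𝒜.parts →
      Branch ψ k N X ∨ (∃ m < n, LooseBranch ψ k N X m) ∨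
      ∃ (F : Set E) (hF : X ⊆ F), ψ (𝒜.enlarge X F hF) < ψ 𝒜 ∧ LooseBranch ψ k N F n := by
  classical
  induction h with
  | leaf X n hX => exact fun 𝒜 h𝒜 hX𝒜 => Or.inl (.leaf X hX (hmono.pair_lt h𝒜 hX𝒜))
  | node X U n ℬ C c hXU hU hℬ hC hch hn ih =>
    intro 𝒜 h𝒜 hX𝒜
    rcases hsub 𝒜 ℬ X U hX𝒜 hU with ⟨F, hF, hFU, hlt⟩ | hle
    · refine Or.inr (Or.inr ⟨F, hF, hlt, ?_⟩)
      -- From $F\subseteq X\cup\bar U$ the set $F$ still misses $U$, so the same subtree hangs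
      -- loosely below $F$ at the same cost.
      refine .node F U n ℬ C c ?_ hU hℬ hC hch hn
      exact (hXU.sup_left disjoint_compl_left).mono_left hFU
    have hUX : U ⊆ Xᶜ := hXU.subset_compl_left
    -- If the root edge is already tight, the repair must happen at a child. Otherwise shrinking to
    -- $X$ enlarges the part towards the root from $U$ to $\bar X$.
    rcases hUX.eq_or_ssubset with rfl | hss
    · by_cases hall : ∀ A ∈ ℬ.parts, A ≠ Xᶜ → Branch ψ k N A
      · exact Or.inl (.node X ℬ hU hℬ hall)
      push Not at hall
      obtain ⟨A, hAℬ, hAU, hnot⟩ := hall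
      have hAC := hC A hAℬ hAU
      right; left
      rcases (ih A hAC ℬ hℬ hAℬ).resolve_left hnot with ⟨m, hm, hAm⟩ | ⟨F, hF, hlt, hFn⟩
      · refine ⟨_, lt_of_lt_of_le (Nat.add_lt_add_left (sum_update_lt c hAC hm) _) hn,
          .node X Xᶜ _ ℬ C _ hXU hU hℬ hC (fun B hB => ?_) le_rfl⟩
        rcases eq_or_ne B A with rfl | h
        · rwa [Function.update_self]
        · rw [Function.update_of_ne h]
          exact hch B hB
      · obtain ⟨C', c', hFC', hC', hch', hle'⟩ := exists_cost_enlarge hN C c hch hAC hFn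
        refine ⟨_, lt_of_lt_of_le (add_lt_add_of_lt_of_le
            (nodeCost_lt_of_lt hlt (Xᶜ \ F) Xᶜ) hle') hn,
          .node X (Xᶜ \ F) _ (ℬ.enlarge A F hF) C' c' (hXU.mono_right Set.sdiff_subset)
            (Or.inr ⟨Xᶜ, ⟨hU, hAU.symm⟩, rfl⟩) (hlt.trans hℬ) ?_ hch' le_rfl⟩
        rintro _ (rfl | ⟨B, ⟨hB, hBA⟩, rfl⟩) hne
        · exact hFC'
        · refine hC' B (hC B hB ?_) hBA
          rintro rfl
          exact hne rfl
    · right; left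
      obtain ⟨c', hch', hle'⟩ := exists_cost_image hN C c hch (fun B => B ∩ X)
        fun B _ => Set.inter_subset_left
      have hUX' : U ∪ Xᶜ = Xᶜ := Set.union_eq_right.2 hUX
      refine ⟨_, lt_of_lt_of_le (add_lt_add_of_lt_of_le
          (nodeCost_lt_of_ssubset hle hss) hle') hn,
        .node X Xᶜ _ (ℬ.shrink U X hU) _ c' disjoint_compl_right (Or.inl hUX'.symm)
          (lt_of_le_of_lt hle hℬ) ?_ hch' le_rfl⟩
      rintro _ (rfl | ⟨B, ⟨hB, hBU⟩, rfl⟩) hne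
      · exact absurd hUX' hne
      · exact Finset.mem_image_of_mem _ (hC B hB hBU)

/-- A partition of value `< k` all of whose parts carry loose branches can be replaced by one all
of whose parts carry branches. -/
theorem exists_forall_branch_of_looseBranch [Finite E] (hsub : IsWeaklySubmodular ψ)
    (hmono : IsMonotoneAt ψ k) (hN : IsLowerSet N) (n : ℕ) :
    ∀ (𝒜 : SetPartition E) (C : Finset (Set E)) (c : Set E → ℕ), ψ 𝒜 < (k : WithTop ℝ) →
      𝒜.parts ⊆ C → (∀ A ∈ C, LooseBranch ψ k N A (c A)) →
      nodeCost ψ 𝒜 Set.univ + ∑ A ∈ C, c A = n →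
      ∃ ℬ : SetPartition E, ψ ℬ < (k : WithTop ℝ) ∧ ∀ A ∈ ℬ.parts, Branch ψ k N A := by
  classical
  induction n using Nat.strong_induction_on with
  | _ n ih =>
    rintro 𝒜 C c h𝒜 hC hch rfl
    by_cases hall : ∀ A ∈ 𝒜.parts, Branch ψ k N A
    · exact ⟨𝒜, h𝒜, hall⟩
    push Not at hall
    obtain ⟨A, hA, hnot⟩ := hall
    have hAC := hC hA
    rcases ((hch A hAC).branch_or_improve hsub hmono hN 𝒜 h𝒜 hA).resolve_left hnot with
      ⟨m, hm, hAm⟩ | ⟨F, hF, hlt, hFn⟩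
    · refine ih _ (Nat.add_lt_add_left (sum_update_lt c hAC hm) _) 𝒜 C _ h𝒜 hC
        (fun B hB => ?_) rfl
      rcases eq_or_ne B A with rfl | h
      · rwa [Function.update_self]
      · rw [Function.update_of_ne h]
        exact hch B hB
    · obtain ⟨C', c', hFC', hC', hch', hle'⟩ := exists_cost_enlarge hN C c hch hAC hFn
      -- The top partition has no part towards a root; `Set.univ` makes the second summand of its
      -- cost zero.
      refine ih _ (add_lt_add_of_lt_of_le (nodeCost_lt_of_lt hlt _ _) hle') (𝒜.enlarge A F hF)
        C' c' (hlt.trans h𝒜) ?_ hch' rfl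
      rintro _ (rfl | ⟨B, ⟨hB, hBA⟩, rfl⟩)
      · exact hFC'
      · exact hC' B (hC hB) hBA

/-! ### Gluing and rerooting branches -/

theorem Branch.exists_looseBranch [Finite E] {X : Set E} (h : Branch ψ k N X) :
    ∃ n, LooseBranch ψ k N X n := by
  induction h with
  | leaf X hX _ => exact ⟨0, .leaf X 0 hX⟩
  | node X 𝒜 hX h𝒜 _ ih =>
    choose! c hc using ih
    have hfin := (𝒜.parts \ {Xᶜ}).toFinite
    exact ⟨_, .node X Xᶜ _ 𝒜 hfin.toFinset c disjoint_compl_right hX h𝒜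
      (fun A hA hne => hfin.mem_toFinset.2 ⟨hA, hne⟩)
      (fun A hA => hc A (hfin.mem_toFinset.1 hA).1 (hfin.mem_toFinset.1 hA).2) le_rfl⟩

theorem Branch.pair_lt (hmono : IsMonotoneAt ψ k) {X : Set E} (h : Branch ψ k N X) :
    ψ (SetPartition.pair X) < (k : WithTop ℝ) := by
  cases h with
  | leaf _ _ h => exact h
  | node _ 𝒜 hX h𝒜 _ =>
    rw [← SetPartition.pair_compl]
    exact hmono.pair_lt h𝒜 hX

theorem SetPartition.parts_nonempty [Nonempty E] (𝒜 : SetPartition E) : 𝒜.parts.Nonempty := by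
  obtain ⟨x⟩ := ‹Nonempty E›
  obtain ⟨A, hA, -⟩ : x ∈ ⋃₀ 𝒜.parts := 𝒜.sUnion_eq ▸ Set.mem_univ x
  exact ⟨A, hA⟩

/-- Cut the tree at the edge towards any part $A$: one side is the branch at $A$, the other has the
node `𝒜` on top and root label $\bar A$. -/
theorem exists_branch_compl_of_forall_branch [Nonempty E] {𝒜 : SetPartition E}
    (h𝒜 : ψ 𝒜 < (k : WithTop ℝ)) (h : ∀ A ∈ 𝒜.parts, Branch ψ k N A) :
    ∃ X, Branch ψ k N X ∧ Branch ψ k N Xᶜ := by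
  obtain ⟨A, hA⟩ := 𝒜.parts_nonempty
  exact ⟨A, h A hA, .node _ 𝒜 (by rwa [compl_compl]) h𝒜 fun B hB _ => h B hB⟩

/-- Two branches whose labels cover `E` can be glued to a tree. -/
theorem exists_branch_compl_of_disjoint [Finite E] [Nonempty E] (hsub : IsWeaklySubmodular ψ)
    (hmono : IsMonotoneAt ψ k) (hN : IsLowerSet N) {A B : Set E} (hAB : Disjoint A B)
    (hA : Branch ψ k N Aᶜ) (hB : Branch ψ k N Bᶜ) : ∃ X, Branch ψ k N X ∧ Branch ψ k N Xᶜ := by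
  cases hA with
  | leaf _ hX _ =>
    have := hB.pair_lt hmono
    rw [SetPartition.pair_compl] at this
    -- Since $B\subseteq\bar A\in N$, the set $B$ is itself an admissible leaf opposite $\bar B$.
    exact ⟨B, .leaf B (hN hAB.subset_compl_left hX) this, hB⟩
  | node _ 𝒜 hA h𝒜 h =>
    rw [compl_compl] at hA h
    have hall : ∀ X ∈ 𝒜.parts, ∃ n, LooseBranch ψ k N X n := by
      intro X hX
      by_cases hXA : X = A
      · obtain ⟨n, hn⟩ := hB.exists_looseBranch
        -- The branch at $\bar B$ is hung loosely on the part $A\subseteq\bar B$.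
        exact ⟨n, hn.mono hN (hXA ▸ hAB.subset_compl_right)⟩
      · exact (h X hX hXA).exists_looseBranch
    choose! c hc using hall
    have hfin := 𝒜.parts.toFinite
    obtain ⟨ℬ, hℬ, hall⟩ := exists_forall_branch_of_looseBranch hsub hmono hN _ 𝒜 hfin.toFinset c
      h𝒜 (by simp) (fun X hX => hc X (hfin.mem_toFinset.1 hX)) rfl
    exact exists_branch_compl_of_forall_branch hℬ hall

/-- A branch that may use `A` as a leaf either does not use it, or can be rerooted at it. -/
theorem Branch.of_insert {A : Set E} (hA : A.Nonempty) {X : Set E}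
    (h : Branch ψ k (insert A N) X) :
    Branch ψ k N X ∨ (A ⊆ X ∧ (Branch ψ k N Xᶜ → Branch ψ k N Aᶜ)) := by
  induction h with
  | leaf X hX hψ =>
    rcases hX with rfl | hX
    · exact Or.inr ⟨subset_rfl, id⟩
    · exact Or.inl (.leaf X hX hψ)
  | node X 𝒜 hX h𝒜 _ ih =>
    by_cases hall : ∀ Y ∈ 𝒜.parts, Y ≠ Xᶜ → Branch ψ k N Y
    · exact Or.inl (.node X 𝒜 hX h𝒜 hall)
    push Not at hall
    obtain ⟨Y, hY, hYX, hnot⟩ := hall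
    obtain ⟨hAY, himp⟩ := (ih Y hY hYX).resolve_left hnot
    refine Or.inr ⟨hAY.trans (by simpa using (𝒜.disjoint Y hY _ hX hYX).subset_compl_right),
      fun hXc => himp (.node _ 𝒜 (by rwa [compl_compl]) h𝒜 fun Z hZ hZY => ?_)⟩
    rw [compl_compl] at hZY
    by_cases hZX : Z = Xᶜ
    · exact hZX ▸ hXc
    -- Only one child can need the leaf $A$: a second one would also contain the non-empty set $A$,
    -- but parts are disjoint.
    · refine (ih Z hZ hZX).resolve_right fun hAZ => ?_
      exact hA.ne_empty (Set.subset_empty_iff.1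
        ((Set.subset_inter hAZ.1 hAY).trans (𝒜.disjoint Z hZ Y hY hZY).le_bot))

/-- Being non-empty, $A$ cannot lie in both $X$ and $\bar X$, so at least one side does without the
leaf $A$ and the other is rerooted at it. -/
theorem branch_compl_of_insert {A : Set E} (hA : A.Nonempty)
    (h : ∃ X, Branch ψ k (insert A N) X ∧ Branch ψ k (insert A N) Xᶜ)
    (hnot : ¬ ∃ X, Branch ψ k N X ∧ Branch ψ k N Xᶜ) : Branch ψ k N Aᶜ := by
  obtain ⟨X, h1, h2⟩ := h
  rcases h1.of_insert hA with h1 | ⟨hAX, h1⟩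
  · rcases h2.of_insert hA with h2 | ⟨-, h2⟩
    · exact absurd ⟨X, h1, h2⟩ hnot
    · exact h2 (by rwa [compl_compl])
  · rcases h2.of_insert hA with h2 | ⟨hAX', -⟩
    · exact h1 h2
    · exact absurd (Set.subset_empty_iff.1
        ((Set.subset_inter hAX hAX').trans (Set.inter_compl_self X).subset)) hA.ne_empty

/-- If no tree has all its leaves labelled by sets of at most one element, then the complement of
a maximal down-set of labels from which no tree can be built is a bramble. -/
theorem exists_isBramble_of_not_exists_branch [Finite E] (hsub : IsWeaklySubmodular ψ)
    (hmono : IsMonotoneAt ψ k) (hS : (sepSystem ψ k).Nonempty)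
    (hnot : ¬ ∃ X, Branch ψ k {Y : Set E | Y.ncard ≤ 1} X ∧
      Branch ψ k {Y : Set E | Y.ncard ≤ 1} Xᶜ) :
    ∃ B : Set (Set E), IsBramble ψ k B ∧ IsNonprincipal B := by
  obtain ⟨s, hs⟩ := hS
  have hne : Nonempty E := by
    by_contra hE
    rw [not_nonempty_iff] at hE
    refine hnot ⟨s.fst, .leaf _ ?_ hs, .leaf _ ?_ (by rw [SetPartition.pair_compl]; exact hs)⟩ <;>
      simp [Set.eq_empty_of_isEmpty]
  let Q : Set (Set (Set E)) := {N | {Y | Y.ncard ≤ 1} ⊆ N ∧ IsLowerSet N ∧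
    ¬ ∃ X, Branch ψ k N X ∧ Branch ψ k N Xᶜ}
  have hQ : Q.Nonempty := ⟨{Y | Y.ncard ≤ 1}, subset_rfl,
    fun X Y hYX hX => (Set.ncard_le_ncard hYX (Set.toFinite _)).trans hX, hnot⟩
  obtain ⟨N, ⟨hsmall, hN, hnot⟩, hmax⟩ := Q.toFinite.exists_maximal hQ
  have hempty : ∅ ∈ N := hsmall (by simp)
  -- Minimality of $A$ keeps `insert A N` a down-set, so maximality of $N$ yields a tree over it.
  have hbranch : ∀ A, A ∉ N → (∀ Y, Y ⊆ A → Y ∉ N → Y = A) → Branch ψ k N Aᶜ := by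
    intro A hA hmin
    refine branch_compl_of_insert (Set.nonempty_iff_ne_empty.2 fun h => hA (h ▸ hempty)) ?_ hnot
    by_contra hcon
    refine hA (hmax (y := insert A N) ⟨hsmall.trans (Set.subset_insert _ _), ?_, hcon⟩
      (Set.subset_insert _ _) (Set.mem_insert _ _))
    rintro X Y hYX (rfl | hX)
    · by_cases hY : Y ∈ N
      · exact Or.inr hY
      · exact Or.inl (hmin Y hYX hY)
    · exact Or.inr (hN hYX hX)
  have hminimal : ∀ X ∉ N, ∃ A ⊆ X, Branch ψ k N Aᶜ := by
    intro X hX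
    obtain ⟨A, hAX, hA⟩ := Finite.exists_le_minimal (p := fun A : Set E => A ∉ N) hX
    exact ⟨A, hAX, hbranch A hA.1 fun Y hY hYN => hY.antisymm (hA.2 hYN hY)⟩
  have hmem : ∀ 𝒜 : SetPartition E, ψ 𝒜 < (k : WithTop ℝ) → ∃ A ∈ 𝒜.parts, A ∈ Nᶜ := by
    intro 𝒜 h𝒜
    by_contra! hall
    exact hnot (exists_branch_compl_of_forall_branch h𝒜 fun A hA =>
      .leaf A (not_not.1 (hall A hA)) (hmono.pair_lt h𝒜 hA))
  refine ⟨Nᶜ, ⟨?_, ?_, hmem⟩, fun e he => he (hsmall (by simp))⟩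
  · obtain ⟨A, -, hA⟩ := hmem _ hs
    exact ⟨A, hA⟩
  · intro X hX Y hY
    by_contra hXY
    rw [Set.not_nonempty_iff_eq_empty, ← Set.disjoint_iff_inter_eq_empty] at hXY
    obtain ⟨A, hAX, hA⟩ := hminimal X hX
    obtain ⟨B, hBY, hB⟩ := hminimal Y hY
    exact hnot (exists_branch_compl_of_disjoint hsub hmono hN (hXY.mono hAX hBY) hA hB)

end Branches

/-! ### Search trees from branches -/

section SearchTrees

variable {E : Type*}

/-- The condition on a vertex whose incoming edge has label `Y` and whose children `C` have
labels `X`: it is a leaf with a small label, or the labels of the outgoing edges form a partition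
of value `< k`. -/
def IsSearchNode (ψ : SetPartition E → WithTop ℝ) (k : ℝ) (Y : Set E) {V : Type} (C : Set V)
    (X : V → Set E) : Prop :=
  (C = ∅ ∧ Y.ncard ≤ 1 ∧ ψ (SetPartition.pair Y) < (k : WithTop ℝ)) ∨
    (C.Nonempty ∧ C.Pairwise (fun v w => Disjoint (X v) (X w)) ∧ (∀ v ∈ C, X v ⊆ Y) ∧
      ∃ 𝒜 : SetPartition E, 𝒜.parts = insert Yᶜ (X '' C) ∧ ψ 𝒜 < (k : WithTop ℝ))

/-- A finite rooted tree, given by a parent function, with labels as in a partitioning `k`-search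
tree in which the root hangs on a further edge with label `Y`. -/
structure RootedSearchTree (ψ : SetPartition E → WithTop ℝ) (k : ℝ) (Y : Set E) where
  V : Type
  finite : Finite V
  parent : V → Option V
  root : V
  depth : V → ℕ
  label : V → Set E
  parent_root : parent root = none
  eq_root : ∀ v, parent v = none → v = root
  depth_lt : ∀ v w, parent v = some w → depth w < depth v
  label_root : label root = Y
  node : ∀ v, IsSearchNode ψ k (label v) {w | parent w = some v} label

variable {ψ : SetPartition E → WithTop ℝ} {k : ℝ}

theorem IsSearchNode.image {Y : Set E} {V W : Type} {C : Set V} {X : V → Set E} {X' : W → Set E}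
    (h : IsSearchNode ψ k Y C X) (f : V → W) (hf : ∀ v, X' (f v) = X v) :
    IsSearchNode ψ k Y (f '' C) X' := by
  rcases h with ⟨rfl, h⟩ | ⟨hne, hdisj, hsub, 𝒜, h𝒜, hψ⟩
  · exact Or.inl ⟨Set.image_empty f, h⟩
  · refine Or.inr ⟨hne.image f, ?_, ?_, 𝒜, ?_, hψ⟩
    · rintro _ ⟨v, hv, rfl⟩ _ ⟨w, hw, rfl⟩ hvw
      rw [hf, hf]
      exact hdisj hv hw fun h => hvw (h ▸ rfl)
    · rintro _ ⟨v, hv, rfl⟩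
      rw [hf]
      exact hsub v hv
    · rw [h𝒜, Set.image_image]
      simp only [hf]

/-- The tree with a single vertex. -/
def RootedSearchTree.single {Y : Set E} (hY : Y.ncard ≤ 1)
    (hψ : ψ (SetPartition.pair Y) < (k : WithTop ℝ)) : RootedSearchTree ψ k Y where
  V := Unit
  finite := inferInstance
  parent _ := none
  root := ()
  depth _ := 0
  label _ := Y
  parent_root := rfl
  eq_root _ _ := rfl
  depth_lt _ _ h := by cases h
  label_root := rfl
  node _ := Or.inl ⟨by simp, hY, hψ⟩

/-- Joining rooted trees at a new root. -/
def RootedSearchTree.join {Y : Set E} {n : ℕ} {X : Fin n → Set E}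
    (t : ∀ i, RootedSearchTree ψ k (X i)) (hY : IsSearchNode ψ k Y Set.univ X) :
    RootedSearchTree ψ k Y where
  V := Option (Σ i, (t i).V)
  finite := by
    have := fun i => (t i).finite
    infer_instance
  parent x := x.map fun v => ((t v.1).parent v.2).map fun w => ⟨v.1, w⟩
  root := none
  depth x := x.elim 0 fun v => (t v.1).depth v.2 + 1
  label x := x.elim Y fun v => (t v.1).label v.2
  parent_root := rfl
  eq_root
    | none, _ => rfl
    | some _, h => by cases h
  depth_lt := by
    rintro (_ | ⟨i, v⟩) (_ | ⟨j, w⟩) h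
    · cases h
    · cases h
    · simp
    · simp only [Option.map_some, Option.some.injEq, Option.map_eq_some_iff] at h
      obtain ⟨u, hu, h⟩ := h
      cases h
      simpa using (t i).depth_lt v _ hu
  label_root := rfl
  node := by
    rintro (_ | ⟨i, v⟩)
    · convert hY.image (W := Option (Σ i, (t i).V))
        (X' := fun x => x.elim Y fun v => (t v.1).label v.2)
        (fun i => some ⟨i, (t i).root⟩) (fun i => (t i).label_root) using 1
      · rfl
      ext (_ | ⟨j, w⟩)
      · simp
      · simp only [Option.map_some, Set.mem_ofPred_eq, Option.some.injEq, Option.map_eq_none_iff,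
          Set.image_univ, Set.mem_range]
        constructor
        · intro h
          exact ⟨j, by rw [(t j).eq_root w h]⟩
        · rintro ⟨i, h⟩
          cases h
          exact (t _).parent_root
    · convert ((t i).node v).image (W := Option (Σ i, (t i).V))
        (X' := fun x => x.elim Y fun v => (t v.1).label v.2)
        (fun w => some ⟨i, w⟩) (fun w => rfl) using 1
      · rfl
      ext (_ | ⟨j, w⟩)
      · simp
      · simp only [Set.mem_ofPred_eq, Option.some.injEq, Option.map_eq_some_iff, Set.mem_image]
        constructor
        · rintro ⟨_, rfl, u, hu, h⟩
          cases h
          exact ⟨w, hu, rfl⟩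
        · rintro ⟨u, hu, h⟩
          cases h
          exact ⟨_, rfl, v, hu, rfl⟩

theorem Branch.nonempty_rootedSearchTree [Finite E] (hmono : IsMonotoneAt ψ k) {Y : Set E}
    (h : Branch ψ k {Z : Set E | Z.ncard ≤ 1} Y) : Nonempty (RootedSearchTree ψ k Y) := by
  induction h with
  | leaf Y hY hψ => exact ⟨.single hY hψ⟩
  | node Y 𝒜 hY h𝒜 _ ih =>
    -- Indexing the children by `Fin n` keeps the vertices in `Type`, whatever the universe of `E`.
    obtain ⟨n, ⟨e⟩⟩ := Finite.exists_equiv_fin ↥(𝒜.parts \ {Yᶜ})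
    have hne : ∀ i, Nonempty (RootedSearchTree ψ k (e.symm i).1) := fun i =>
      ih _ (e.symm i).2.1 (e.symm i).2.2
    have himage : 𝒜.parts = insert Yᶜ ((fun i => (e.symm i).1) '' Set.univ) := by
      have : (fun i => (e.symm i).1) '' Set.univ = 𝒜.parts \ {Yᶜ} := by
        rw [Set.image_univ]
        exact (e.symm.surjective.range_comp Subtype.val).trans Subtype.range_val
      rw [this, Set.insert_sdiff_singleton, Set.insert_eq_of_mem hY]
    -- A node without children has the only part $\bar Y=E$, so it turns into a leaf with label
    -- $\emptyset$.
    rcases isEmpty_or_nonempty (Fin n) with hn | hn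
    · rw [Set.univ_eq_empty_iff.2 hn, Set.image_empty] at himage
      have hY' : Y = ∅ := by
        have := 𝒜.sUnion_eq
        rw [himage] at this
        simpa using this
      refine ⟨.single (by simp [hY']) ?_⟩
      rw [← SetPartition.pair_compl]
      exact hmono.pair_lt h𝒜 hY
    · refine ⟨.join (fun i => (hne i).some)
        (Or.inr ⟨Set.univ_nonempty, ?_, ?_, 𝒜, himage, h𝒜⟩)⟩
      · intro i _ j _ hij
        exact 𝒜.disjoint _ (e.symm i).2.1 _ (e.symm j).2.1 fun h =>
          hij (e.symm.injective (Subtype.ext h))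
      · intro i _
        simpa using (𝒜.disjoint _ (e.symm i).2.1 _ hY (e.symm i).2.2).subset_compl_right

/-! ### Trees from parent functions -/

/-- The graph in which every vertex is adjacent to its parent. -/
def parentGraph {V : Type} (p : V → V) : SimpleGraph V := SimpleGraph.fromRel fun x y => p x = y

theorem parentGraph_adj {V : Type} {p : V → V} (hp : ∀ v, p v ≠ v) {x y : V} :
    (parentGraph p).Adj x y ↔ p x = y ∨ p y = x := by
  rw [parentGraph, SimpleGraph.fromRel_adj, and_iff_right_iff_imp]
  rintro (rfl | rfl)
  · exact (hp _).symm
  · exact hp _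

/-- Following parents leads to `r`, so the graph is connected. The edges $\{v,p(v)\}$ with $v\ne r$
are all the edges, as the one at `r` recurs at `p r`; hence there are at most $|V|-1$. -/
theorem parentGraph_isTree {V : Type} [Finite V] {p : V → V} {r : V} {depth : V → ℕ}
    (hp : ∀ v, p v ≠ v) (hr : p (p r) = r) (hdepth : ∀ v, v ≠ r → depth (p v) < depth v) :
    (parentGraph p).IsTree := by
  have hreach : ∀ n v, depth v = n → (parentGraph p).Reachable v r := by
    intro n
    induction n using Nat.strong_induction_on with
    | _ n ih =>
      rintro v rfl
      by_cases hv : v = r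
      · rw [hv]
      · exact ((parentGraph_adj hp).2 (Or.inl rfl)).reachable.trans (ih _ (hdepth v hv) _ rfl)
  have hconn : (parentGraph p).Connected :=
    { preconnected := fun v w => (hreach _ v rfl).trans (hreach _ w rfl).symm
      nonempty := ⟨r⟩ }
  refine SimpleGraph.isTree_iff_connected_and_card.2
    ⟨hconn, le_antisymm ?_ hconn.card_vert_le_card_edgeSet_add_one⟩
  let f : {v // v ≠ r} → (parentGraph p).edgeSet := fun v =>
    ⟨s(v.1, p v.1), (parentGraph_adj hp).2 (Or.inl rfl)⟩
  have key : ∀ v, ∃ w, (f w).1 = s(v, p v) := by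
    intro v
    by_cases hv : v = r
    · exact ⟨⟨p r, hp r⟩, by simp [f, hr, hv, Sym2.eq_swap]⟩
    · exact ⟨⟨v, hv⟩, rfl⟩
  have hf : Function.Surjective f := by
    rintro ⟨e, he⟩
    induction e with
    | _ x y =>
      rcases (parentGraph_adj hp).1 ((SimpleGraph.mem_edgeSet _).1 he) with rfl | rfl
      · obtain ⟨w, hw⟩ := key x
        exact ⟨w, Subtype.ext hw⟩
      · obtain ⟨w, hw⟩ := key y
        exact ⟨w, Subtype.ext (hw.trans Sym2.eq_swap)⟩
  have h1 := Nat.card_le_card_of_surjective f hf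
  have h2 : Nat.card {v // v ≠ r} + 1 = Nat.card V := by
    have := Set.ncard_add_ncard_compl ({r}ᶜ : Set V)
    rw [compl_compl, Set.ncard_singleton] at this
    exact this
  omega

/-- A partitioning search tree from a parent function without fixed points, whose only cycle is
the edge joining `r` to its parent. -/
theorem existsPartitioningSearchTree_of_parent {V : Type} [Finite V] (p : V → V) (r : V)
    (depth : V → ℕ) (X : V → Set E) (hpr : p r ≠ r) (hr : p (p r) = r)
    (hdepth : ∀ v, v ≠ r → depth (p v) < depth v) (hX : X (p r) = (X r)ᶜ)
    (hnode : ∀ v, IsSearchNode ψ k (X v) {w | p w = v ∧ w ≠ p v} X) :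
    ExistsPartitioningSearchTree ψ k := by
  classical
  have hp : ∀ v, p v ≠ v := by
    intro v hv
    by_cases h : v = r
    · exact hpr (h ▸ hv)
    · exact (hdepth v h).ne (congrArg depth hv)
  have hX' : ∀ v, p (p v) = v → X (p v) = (X v)ᶜ := by
    intro v hv
    by_cases h : v = r
    · exact h ▸ hX
    by_cases h' : p v = r
    · rw [h'] at hv ⊢
      rw [← hv, hX, compl_compl]
    · have h1 := hdepth v h
      have h2 := hdepth _ h'
      rw [hv] at h2
      omega
  have hadj := fun x y => parentGraph_adj (x := x) (y := y) hp
  -- Both rules apply to the central edge between `r` and `p r`, where they agree by `hX'`.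
  let l : (parentGraph p).Dart → Set E := fun d =>
    if p d.snd = d.fst then X d.snd else (X d.fst)ᶜ
  have hchild : ∀ d : (parentGraph p).Dart, p d.snd = d.fst → l d = X d.snd := fun d h => if_pos h
  have hparent : ∀ d : (parentGraph p).Dart, p d.fst = d.snd → l d = (X d.fst)ᶜ := by
    intro d h
    by_cases h' : p d.snd = d.fst
    · rw [hchild d h', ← h]
      exact hX' _ (by rw [h, h'])
    · exact if_neg h'
  have hnbr : ∀ t, (parentGraph p).neighborSet t = insert (p t) {w | p w = t ∧ w ≠ p t} := by
    intro t
    ext w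
    simp only [SimpleGraph.mem_neighborSet, hadj, Set.mem_insert_iff, Set.mem_ofPred_eq]
    grind
  have hcard : ∀ t, ((parentGraph p).neighborSet t).ncard
      = {w | p w = t ∧ w ≠ p t}.ncard + 1 := by
    intro t
    rw [hnbr, Set.ncard_insert_of_notMem (by simp) (Set.toFinite _)]
  have hbig : ∀ t, 2 ≤ ((parentGraph p).neighborSet t).ncard →
      {w | p w = t ∧ w ≠ p t} ≠ ∅ := by
    intro t ht h
    rw [hcard, h, Set.ncard_empty] at ht
    omega
  have hcases : ∀ d : (parentGraph p).Dart, (p d.fst = d.snd ∧ l d = (X d.fst)ᶜ) ∨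
      ((p d.snd = d.fst ∧ d.snd ≠ p d.fst) ∧ l d = X d.snd) := by
    intro d
    by_cases h : p d.fst = d.snd
    · exact Or.inl ⟨h, hparent d h⟩
    · have h' := ((hadj _ _).1 d.adj).resolve_left h
      exact Or.inr ⟨⟨h', fun h'' => h h''.symm⟩, hchild d h'⟩
  refine ⟨V, ‹_›, parentGraph p, l, parentGraph_isTree hp hr hdepth,
    ⟨⟨(r, p r), (hadj _ _).2 (Or.inl rfl)⟩⟩, ?_, ?_, ?_, ?_⟩
  · intro d
    rcases (hadj _ _).1 d.adj with h | h
    · rw [hparent d h, hchild d.symm h, compl_compl]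
      rfl
    · rw [hchild d h, hparent d.symm h]
      rfl
  · intro d hd
    rw [hcard, Nat.add_eq_right, Set.ncard_eq_zero (Set.toFinite _)] at hd
    have hl : l d = X d.snd := by
      refine hchild d ?_
      by_contra hne
      have h := ((hadj _ _).1 d.adj).resolve_right hne
      exact Set.eq_empty_iff_forall_notMem.1 hd d.fst ⟨h, Ne.symm hne⟩
    rcases hnode d.snd with ⟨-, h⟩ | ⟨h, -⟩
    · rwa [hl]
    · exact absurd hd h.ne_empty
  · rintro t ht d d' rfl hd' hne
    obtain ⟨-, hdisj, hsub, -⟩ := (hnode d.fst).resolve_left fun h => hbig _ ht h.1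
    have hsnd : d.snd ≠ d'.snd := fun h => hne (SimpleGraph.Dart.ext _ _ (Prod.ext hd'.symm h))
    have h1 := hcases d
    have h2 := hcases d'
    rw [hd'] at h2
    rcases h1 with ⟨e1, h1⟩ | ⟨e1, h1⟩ <;> rcases h2 with ⟨e2, h2⟩ | ⟨e2, h2⟩ <;> rw [h1, h2]
    · exact absurd (e1.symm.trans e2) hsnd
    · exact disjoint_compl_left.mono_right (hsub _ e2)
    · exact disjoint_compl_right.mono_left (hsub _ e1)
    · exact hdisj e1 e2 hsnd
  · intro t ht
    obtain ⟨-, -, -, 𝒜, h𝒜, hψ⟩ := (hnode t).resolve_left fun h => hbig _ ht h.1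
    refine ⟨𝒜, ?_, hψ⟩
    rw [h𝒜]
    ext Z
    constructor
    · rintro (rfl | ⟨w, hw, rfl⟩)
      · exact ⟨⟨(t, p t), (hadj _ _).2 (Or.inl rfl)⟩, rfl, hparent _ rfl⟩
      · exact ⟨⟨(t, w), (hadj _ _).2 (Or.inr hw.1)⟩, rfl, hchild _ hw.1⟩
    · rintro ⟨d, rfl, rfl⟩
      rcases hcases d with ⟨-, h⟩ | ⟨h, h'⟩
      · exact Or.inl h
      · exact Or.inr ⟨d.snd, h, h'.symm⟩

/-- Two rooted trees with complementary root labels can be joined by an edge. -/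
theorem existsPartitioningSearchTree_of_rooted {Y : Set E} (s : RootedSearchTree ψ k Y)
    (t : RootedSearchTree ψ k Yᶜ) : ExistsPartitioningSearchTree ψ k := by
  have := s.finite
  have := t.finite
  -- Each root becomes the parent of the other. The shift of depths in `t` below places its root
  -- deeper than that of `s`.
  let p : s.V ⊕ t.V → s.V ⊕ t.V := Sum.elim
    (fun v => (s.parent v).elim (Sum.inr t.root) Sum.inl)
    (fun v => (t.parent v).elim (Sum.inl s.root) Sum.inr)
  have hs : p (Sum.inl s.root) = Sum.inr t.root := by simp [p, s.parent_root]
  have ht : p (Sum.inr t.root) = Sum.inl s.root := by simp [p, t.parent_root]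
  refine existsPartitioningSearchTree_of_parent p (Sum.inl s.root)
    (Sum.elim s.depth fun v => t.depth v + s.depth s.root + 1) (Sum.elim s.label t.label)
    (by simp [hs]) (by rw [hs, ht]) ?_ (by simp [hs, s.label_root, t.label_root]) ?_
  · rintro (v | v) hv
    · rcases h : s.parent v with _ | w
      · exact absurd (congrArg _ (s.eq_root v h)) hv
      · simpa [p, h] using s.depth_lt v w h
    · rcases h : t.parent v with _ | w
      · simp only [p, Sum.elim_inr, h, Option.elim_none, Sum.elim_inl]
        omega
      · simpa [p, h] using t.depth_lt v w h
  · rintro (v | v)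
    · convert (s.node v).image (W := s.V ⊕ t.V) (X' := Sum.elim s.label t.label) Sum.inl
        (fun w => rfl) using 1
      · rfl
      ext (w | w)
      · rcases h : s.parent w with _ | u
        · simp [p, h]
        · simp only [Set.mem_ofPred_eq, p, Sum.elim_inl, h, Option.elim_some, Sum.inl.injEq,
            Set.mem_image, exists_eq_right, Option.some.injEq, and_iff_left_iff_imp]
          rintro rfl h'
          -- Within one tree no two vertices are parents of each other, because depth decreases.
          rcases hu : s.parent u with _ | x
          · simp [hu] at h'
          · obtain rfl : w = x := by simpa [hu] using h'
            exact (s.depth_lt _ _ h).asymm (s.depth_lt _ _ hu)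
      · rcases h : t.parent w with _ | u
        · simp only [Set.mem_ofPred_eq, p, Sum.elim_inr, h, Option.elim_none, Sum.inl.injEq]
          simp only [Sum.elim_inl, Set.mem_image, reduceCtorEq, and_false, exists_false, iff_false,
            not_and, not_not]
          rintro rfl
          simp [s.parent_root, t.eq_root w h]
        · simp [p, h]
    · convert (t.node v).image (W := s.V ⊕ t.V) (X' := Sum.elim s.label t.label) Sum.inr
        (fun w => rfl) using 1
      · rfl
      ext (w | w)
      · rcases h : s.parent w with _ | u
        · simp only [Set.mem_ofPred_eq, p, Sum.elim_inl, h, Option.elim_none, Sum.inr.injEq]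
          simp only [Sum.elim_inr, Set.mem_image, reduceCtorEq, and_false, exists_false, iff_false,
            not_and, not_not]
          rintro rfl
          simp [t.parent_root, s.eq_root w h]
        · simp [p, h]
      · rcases h : t.parent w with _ | u
        · simp [p, h]
        · simp only [Set.mem_ofPred_eq, p, Sum.elim_inr, h, Option.elim_some, Sum.inr.injEq,
            Set.mem_image, exists_eq_right, Option.some.injEq, and_iff_left_iff_imp]
          rintro rfl h'
          rcases hu : t.parent u with _ | x
          · simp [hu] at h'
          · obtain rfl : w = x := by simpa [hu] using h'
            exact (t.depth_lt _ _ h).asymm (t.depth_lt _ _ hu)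

/-- If no partition has value `< k` then all of `E` is a bramble by itself. -/
theorem exists_isBramble_of_sepSystem_eq_empty [Finite E] (hmono : IsMonotoneAt ψ k)
    (hS : sepSystem ψ k = ∅) (hE : 2 ≤ Nat.card E) :
    ∃ B : Set (Set E), IsBramble ψ k B ∧ IsNonprincipal B := by
  have hne : Nonempty E := (Nat.card_pos_iff.1 (by omega)).1
  refine ⟨{Set.univ}, ⟨Set.singleton_nonempty _, ?_, fun 𝒜 h𝒜 => ?_⟩, fun e he => ?_⟩
  · rintro _ rfl _ rfl
    simp
  · obtain ⟨A, hA⟩ := 𝒜.parts_nonempty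
    exact absurd (mem_sepSystem_of.2 (hmono.pair_lt h𝒜 hA)) (hS ▸ Set.notMem_empty _)
  · have h := congrArg Set.ncard (Set.mem_singleton_iff.1 he)
    rw [Set.ncard_singleton, Set.ncard_univ] at h
    omega

end SearchTrees

end PartitionDuality

theorem mainTheorem9 {E : Type*} [Finite E] (ψ : PartitionDuality.SetPartition E → WithTop ℝ)
    (k : ℝ) (hk : 0 < k)
    (hsub : PartitionDuality.IsWeaklySubmodular ψ)
    (hmono : PartitionDuality.IsMonotoneAt ψ k)
    (hE : 2 ≤ Nat.card E ∨ (PartitionDuality.sepSystem ψ k).Nonempty) :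
    List.TFAE [
      ∃ B : Set (Set E), PartitionDuality.IsBramble ψ k B ∧ PartitionDuality.IsNonprincipal B,
      ∃ O : Set (PartitionDuality.Bipartition E),
        PartitionDuality.IsTangle (PartitionDuality.sepSystem ψ k)
          (PartitionDuality.forbiddenStars ψ k) O,
      ¬ PartitionDuality.ExistsSTreeOver (PartitionDuality.sepSystem ψ k)
          (PartitionDuality.forbiddenStars ψ k),
      ¬ PartitionDuality.ExistsPartitioningSearchTree ψ k] := by
  open PartitionDuality in
  tfae_have 1 → 2 := fun ⟨_, hB, hB'⟩ => exists_isTangle_of_isBramble hB hB'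
  tfae_have 2 → 3 := fun ⟨_, hO⟩ => not_existsSTreeOver_of_isTangle hO
  tfae_have 3 → 4 := fun h h' => h (existsSTreeOver_of_existsPartitioningSearchTree hmono h')
  tfae_have 4 → 1 := by
    intro h
    rcases (sepSystem ψ k).eq_empty_or_nonempty with hS | hS
    · exact exists_isBramble_of_sepSystem_eq_empty hmono hS
        (hE.resolve_right (Set.not_nonempty_iff_eq_empty.2 hS))
    · refine exists_isBramble_of_not_exists_branch hsub hmono hS fun ⟨X, h1, h2⟩ => h ?_
      obtain ⟨s⟩ := h1.nonempty_rootedSearchTree hmono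
      obtain ⟨t⟩ := h2.nonempty_rootedSearchTree hmono
      exact existsPartitioningSearchTree_of_rooted s t
  tfae_finish
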